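/- Let $0<\epsilon\le 1/2$ and consider the typewriter channel with input and output alphabet $\mathbb{Z}_5$ and transition probabilities $W(x\,|\,x)=1-\epsilon$, $W(x+1\,|\,x)=\epsilon$. All logarithms are to base 2. Let $\mathsf{P}_{\mathrm e}(M,n)$ be the smallest probability of error of codes with $M$ codewords of length $n$, and let $$E(R)=\limsup_{n\to\infty}\frac1n\log\frac{1}{\mathsf{P}_{\mathrm e}(\lceil 2^{nR}\rceil,n)}\in[0,\infty]$$ be the reliability function (with $\log(1/0)=+\infty$). Put $\alpha_\epsilon=\sqrt{\epsilon(1-\epsilon)}$ and $h_5(x)=x\log 4-x\log x-(1-x)\log(1-x)$; for $0\le r\le\log 5$ let $\delta_{GV}(r;5)$ be the unique $\delta\in[0,4/5]$ with $r=\log 5-h_5(\delta)$; and put $$R_+^*(\epsilon;5)=\log 5-\tfrac12\,h_5\!\left(1-\frac1{(1+2\alpha_\epsilon)^2}\right).$$ Then for every $R$ with $\log\sqrt5\le R\le R_+^*(\epsilon;5)$, $$E(R)\ \ge\ -\tfrac12\,\delta_{GV}(2R-\log 5;5)\,\log\bigl(\alpha_\epsilon(1+\alpha_\epsilon)\bigr),$$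 both when the probability of error is averaged over the codewords and when it is the maximum over the codewords. Moreover, if $R<R_+^*(\epsilon;5)$, the right-hand side is strictly larger than the multiletter expurgated exponent $E_{\mathrm{ex}}^\infty(R)=\sup_{k\ge1}\sup_{\rho\ge1}\bigl[-\frac{\rho}{k}\log\min_P\sum_{\mathbf{x}_1,\mathbf{x}_2}P(\mathbf{x}_1)P(\mathbf{x}_2)\,g_k(\mathbf{x}_1,\mathbf{x}_2)^{1/\rho}-\rho R\bigr]$, where $P$ ranges over the probability distributions on $\mathbb{Z}_5^k$, $g_k(\mathbf{x}_1,\mathbf{x}_2)=\sum_{\mathbf{y}\in\mathbb{Z}_5^k}\sqrt{\mathbf{W}(\mathbf{y}|\mathbf{x}_1)\mathbf{W}(\mathbf{y}|\mathbf{x}_2)}$, and $\mathbf{W}$ is the $k$-fold memoryless extension of $W$. -/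

import Mathlib

namespace Typewriter

noncomputable section

/-- Transition probability `W(y | x)` of the typewriter channel on `ℤ/qℤ`
with crossover probability `ε`. -/
def channel (q : ℕ) (ε : ℝ) (x y : ZMod q) : ℝ :=
  if y = x then 1 - ε else if y = x + 1 then ε else 0

/-- The `n`-fold memoryless extension of the channel. -/
def channelN (q : ℕ) (ε : ℝ) (n : ℕ) (x y : Fin n → ZMod q) : ℝ :=
  ∏ i, channel q ε (x i) (y i)

/-- A block code of length `n` with `M` messages over the alphabet `ℤ/qℤ`. -/
structure Code (q M n : ℕ) where
  enc : Fin M → (Fin n → ZMod q)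
  dec : (Fin n → ZMod q) → Fin M

/-- Probability that message `m` is decoded incorrectly. -/
def Code.msgError {q M n : ℕ} [NeZero q] (c : Code q M n) (ε : ℝ) (m : Fin M) : ℝ :=
  ∑ y : Fin n → ZMod q, if c.dec y = m then 0 else channelN q ε n (c.enc m) y

/-- Average (over messages) probability of error. -/
def Code.avgError {q M n : ℕ} [NeZero q] (c : Code q M n) (ε : ℝ) : ℝ :=
  (1 / (M : ℝ)) * ∑ m : Fin M, c.msgError ε m

/-- Maximal (over messages) probability of error. -/
def Code.maxError {q M n : ℕ} [NeZero q] (c : Code q M n) (ε : ℝ) : ℝ :=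
  ⨆ m : Fin M, c.msgError ε m

/-- Smallest average probability of error of codes with `M` codewords of length `n`. -/
def minAvgError (q : ℕ) [NeZero q] (ε : ℝ) (M n : ℕ) : ℝ :=
  ⨅ c : Code q M n, c.avgError ε

/-- Smallest maximal probability of error of codes with `M` codewords of length `n`. -/
def minMaxError (q : ℕ) [NeZero q] (ε : ℝ) (M n : ℕ) : ℝ :=
  ⨅ c : Code q M n, c.maxError ε

/-- `(1/n) log₂ (1/p)`, with value `+∞` when `p = 0`. -/
def expRate (n : ℕ) (p : ℝ) : EReal :=
  if p = 0 then ⊤ else (((1 / (n : ℝ)) * Real.logb 2 (1 / p) : ℝ) : EReal)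

/-- The reliability function `limsup_n (1/n) log₂ (1 / P_e(⌈2^{nR}⌉, n))`,
for the average probability of error. -/
def reliability (q : ℕ) [NeZero q] (ε R : ℝ) : EReal :=
  Filter.limsup
    (fun n : ℕ => expRate n (minAvgError q ε ⌈(2 : ℝ) ^ ((n : ℝ) * R)⌉₊ n)) Filter.atTop

/-- The reliability function for the maximal probability of error. -/
def reliabilityMax (q : ℕ) [NeZero q] (ε R : ℝ) : EReal :=
  Filter.limsup
    (fun n : ℕ => expRate n (minMaxError q ε ⌈(2 : ℝ) ^ ((n : ℝ) * R)⌉₊ n)) Filter.atTop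

/-- `α_ε = √(ε (1 - ε))`. -/
def alpha (ε : ℝ) : ℝ := Real.sqrt (ε * (1 - ε))

/-- The `q`-ary entropy function in bits:
`h_q(x) = x log₂ (q-1) - x log₂ x - (1-x) log₂ (1-x)`. -/
def entropy (q : ℕ) (x : ℝ) : ℝ := Real.qaryEntropy q x / Real.log 2

/-- The relative Gilbert–Varshamov distance: the `δ ∈ [0, 1 - 1/q]` with
`r = log₂ q - h_q(δ)` (it exists and is unique for `q ≥ 2` and `0 ≤ r ≤ log₂ q`). -/
def deltaGV (r : ℝ) (q : ℕ) : ℝ :=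
  sSup {δ : ℝ | 0 ≤ δ ∧ δ ≤ 1 - 1 / (q : ℝ) ∧ r = Real.logb 2 q - entropy q δ}

/-- The rate `R₊*(ε; 5)`. -/
def RPlus5 (ε : ℝ) : ℝ :=
  Real.logb 2 5 - (1 / 2) * entropy 5 (1 - 1 / (1 + 2 * alpha ε) ^ 2)

/-- The kernel `g_k(x₁, x₂) = ∑_y √(W(y|x₁) W(y|x₂))` on blocks of length `k`. -/
def bhatt (q : ℕ) [NeZero q] (ε : ℝ) (k : ℕ) (x₁ x₂ : Fin k → ZMod q) : ℝ :=
  ∑ y : Fin k → ZMod q, Real.sqrt (channelN q ε k x₁ y * channelN q ε k x₂ y)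

/-- The quadratic form `Q^k(ρ, P)`. -/
def quadForm (q : ℕ) [NeZero q] (ε : ℝ) (k : ℕ) (ρ : ℝ) (P : (Fin k → ZMod q) → ℝ) : ℝ :=
  ∑ x₁, ∑ x₂, P x₁ * P x₂ * bhatt q ε k x₁ x₂ ^ (1 / ρ)

/-- `E_x^k(ρ) = -(ρ/k) log₂ min_P Q^k(ρ, P)`, over all probability vectors `P` on blocks of
length `k`. -/
def exFun (q : ℕ) [NeZero q] (ε : ℝ) (k : ℕ) (ρ : ℝ) : ℝ :=
  -(ρ / (k : ℝ)) *
    Real.logb 2 (⨅ P : stdSimplex ℝ (Fin k → ZMod q), quadForm q ε k ρ P.1)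

/-- The `k`-letter expurgated exponent `E_ex^k(R) = sup_{ρ ≥ 1} (E_x^k(ρ) - ρ R)`. -/
def expurgated (q : ℕ) [NeZero q] (ε : ℝ) (k : ℕ) (R : ℝ) : EReal :=
  ⨆ (ρ : ℝ) (_ : 1 ≤ ρ), ((exFun q ε k ρ - ρ * R : ℝ) : EReal)

/-- The multiletter expurgated exponent `E_ex^∞(R) = sup_{k ≥ 1} E_ex^k(R)`. -/
def expurgatedInf (q : ℕ) [NeZero q] (ε R : ℝ) : EReal :=
  ⨆ (k : ℕ) (_ : 1 ≤ k), expurgated q ε k R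

/-- The lower bound `-½ δ_GV(2R - log₂ 5; 5) log₂ (α_ε (1 + α_ε))`. -/
def newBound5 (ε R : ℝ) : ℝ :=
  -(1 / 2) * deltaGV (2 * R - Real.logb 2 5) 5 * Real.logb 2 (alpha ε * (1 + alpha ε))

end

end Typewriter

/-!
By the union bound, a code decoded by maximum likelihood errs on a codeword with probability at most
the sum of the Bhattacharyya coefficients between it and the other codewords. Take as codewords all
`(x, 2 x + c j)` with `x ∈ ℤ₅^m`, for a family of words `c j ∈ ℤ₅^m`. Since `2² = -1` in `ℤ₅`, the
set `{(x, 2 x)}` is Shannon's zero-error code, and summing over `x` collapses the error bound to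
`∑_k β ^ d(c j, c k)` with `d` the Hamming distance, `β = α (1 + α)` and `1 + 4 β = (1 + 2 α)²`. A
family of minimal energy makes this sum at most `β ^ (δ m)` at the Gilbert–Varshamov distance `δ`
as long as `δ ≥ 1 - 1 / (1 + 4 β)`, which is the condition `R ≤ R₊*`.

For the expurgated exponent, the kernel `g_k ^ (1/ρ)` is a tensor power of a circulant kernel whose
Fourier coefficients are nonnegative if `a = α ^ (1/ρ)` is at most `1 / (2 cos (π/5))`; the minimum
over `P` is then attained at the uniform distribution. For larger `a`, monotonicity in `a` makes the
contribution of `ρ` to the exponent nonpositive at rates `R ≥ log √5`. It remains to compare the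
exponent of the uniform distribution with the new bound, which is Gibbs' inequality at `δ`; it is
strict when `R < R₊*`.
-/

namespace Typewriter

open Finset Filter

section Channel

variable {q : ℕ} {ε : ℝ}

theorem channel_nonneg (h0 : 0 ≤ ε) (h1 : ε ≤ 1) (x y : ZMod q) : 0 ≤ channel q ε x y := by
  unfold channel
  split_ifs <;> linarith

theorem channelN_nonneg (h0 : 0 ≤ ε) (h1 : ε ≤ 1) {n : ℕ} (x y : Fin n → ZMod q) :
    0 ≤ channelN q ε n x y :=
  prod_nonneg fun i _ => channel_nonneg h0 h1 (x i) (y i)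

theorem sqrt_channel [Nontrivial (ZMod q)] (x z : ZMod q) :
    √(channel q ε x z) = (if z = x then √(1 - ε) else 0) + if z = x + 1 then √ε else 0 := by
  unfold channel
  split_ifs <;> simp_all

variable [NeZero q]

theorem bhatt_nonneg {n : ℕ} (x y : Fin n → ZMod q) : 0 ≤ bhatt q ε n x y :=
  sum_nonneg fun _ _ => Real.sqrt_nonneg _

theorem Code.msgError_nonneg {M n : ℕ} (h0 : 0 ≤ ε) (h1 : ε ≤ 1) (C : Code q M n) (m : Fin M) :
    0 ≤ C.msgError ε m :=
  sum_nonneg fun _ _ => by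
    split_ifs
    exacts [le_rfl, channelN_nonneg h0 h1 _ _]

theorem Code.avgError_nonneg {M n : ℕ} (h0 : 0 ≤ ε) (h1 : ε ≤ 1) (C : Code q M n) :
    0 ≤ C.avgError ε :=
  mul_nonneg (by positivity) (sum_nonneg fun m _ => C.msgError_nonneg h0 h1 m)

theorem Code.maxError_nonneg {M n : ℕ} (h0 : 0 ≤ ε) (h1 : ε ≤ 1) (C : Code q M n) :
    0 ≤ C.maxError ε :=
  Real.iSup_nonneg (C.msgError_nonneg h0 h1)

theorem minAvgError_nonneg (h0 : 0 ≤ ε) (h1 : ε ≤ 1) (M n : ℕ) : 0 ≤ minAvgError q ε M n :=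
  Real.iInf_nonneg (Code.avgError_nonneg h0 h1)

theorem minMaxError_nonneg (h0 : 0 ≤ ε) (h1 : ε ≤ 1) (M n : ℕ) : 0 ≤ minMaxError q ε M n :=
  Real.iInf_nonneg (Code.maxError_nonneg h0 h1)

theorem minAvgError_le {M n : ℕ} [NeZero M] {p : ℝ} (h0 : 0 ≤ ε) (h1 : ε ≤ 1) (C : Code q M n)
    (hC : ∀ m, C.msgError ε m ≤ p) : minAvgError q ε M n ≤ p := by
  have hM : (0 : ℝ) < M := by exact_mod_cast NeZero.pos M
  have havg : C.avgError ε ≤ p := by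
    rw [Code.avgError, one_div, inv_mul_le_iff₀ hM]
    simpa using sum_le_sum fun m (_ : m ∈ univ) => hC m
  exact (ciInf_le ⟨0, Set.forall_mem_range.2 (Code.avgError_nonneg h0 h1)⟩ C).trans havg

theorem minMaxError_le {M n : ℕ} [NeZero M] {p : ℝ} (h0 : 0 ≤ ε) (h1 : ε ≤ 1) (C : Code q M n)
    (hC : ∀ m, C.msgError ε m ≤ p) : minMaxError q ε M n ≤ p :=
  (ciInf_le ⟨0, Set.forall_mem_range.2 (Code.maxError_nonneg h0 h1)⟩ C).trans (ciSup_le hC)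

theorem le_expRate {n : ℕ} (hn : 0 < n) {p E : ℝ} (hp : 0 ≤ p)
    (hpE : p ≤ 2 ^ (-((n : ℝ) * E))) : (E : EReal) ≤ expRate n p := by
  unfold expRate
  split_ifs with h
  · exact le_top
  · have hlog : Real.logb 2 p ≤ -(n * E) :=
      (Real.logb_le_iff_le_rpow one_lt_two (hp.lt_of_ne' h)).2 hpE
    rw [EReal.coe_le_coe_iff, one_div p, Real.logb_inv, one_div, le_inv_mul_iff₀ (by positivity)]
    linarith

theorem le_limsup_expRate {p : ℕ → ℝ} {E : ℝ} (hp : ∀ n, 0 ≤ p n)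
    (h : ∃ᶠ n : ℕ in atTop, p n ≤ 2 ^ (-((n : ℝ) * E))) :
    (E : EReal) ≤ limsup (fun n => expRate n (p n)) atTop :=
  le_limsup_of_frequently_le <| (h.and_eventually (eventually_gt_atTop 0)).mono
    fun n hn => le_expRate hn.2 (hp n) hn.1

theorem le_reliability {E R : ℝ} (h0 : 0 ≤ ε) (h1 : ε ≤ 1)
    (h : ∃ᶠ n : ℕ in atTop, ∃ C : Code q ⌈(2 : ℝ) ^ ((n : ℝ) * R)⌉₊ n,
      ∀ m, C.msgError ε m ≤ 2 ^ (-((n : ℝ) * E))) :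
    (E : EReal) ≤ reliability q ε R := by
  refine le_limsup_expRate (fun n => minAvgError_nonneg h0 h1 _ n) (h.mono ?_)
  rintro n ⟨C, hC⟩
  have : NeZero ⌈(2 : ℝ) ^ ((n : ℝ) * R)⌉₊ := ⟨(Nat.ceil_pos.2 (by positivity)).ne'⟩
  exact minAvgError_le h0 h1 C hC

theorem le_reliabilityMax {E R : ℝ} (h0 : 0 ≤ ε) (h1 : ε ≤ 1)
    (h : ∃ᶠ n : ℕ in atTop, ∃ C : Code q ⌈(2 : ℝ) ^ ((n : ℝ) * R)⌉₊ n,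
      ∀ m, C.msgError ε m ≤ 2 ^ (-((n : ℝ) * E))) :
    (E : EReal) ≤ reliabilityMax q ε R := by
  refine le_limsup_expRate (fun n => minMaxError_nonneg h0 h1 _ n) (h.mono ?_)
  rintro n ⟨C, hC⟩
  have : NeZero ⌈(2 : ℝ) ^ ((n : ℝ) * R)⌉₊ := ⟨(Nat.ceil_pos.2 (by positivity)).ne'⟩
  exact minMaxError_le h0 h1 C hC

/- The Bhattacharyya union bound: an error at `y` for maximum likelihood decoding means that the
decoded codeword `x'` has `W(y|x) ≤ W(y|x')`, hence `W(y|x) ≤ √(W(y|x) W(y|x'))`. -/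
theorem exists_dec_msgError_le_sum_bhatt {M n : ℕ} [NeZero M] (h0 : 0 ≤ ε) (h1 : ε ≤ 1)
    (enc : Fin M → Fin n → ZMod q) :
    ∃ dec, ∀ m, (⟨enc, dec⟩ : Code q M n).msgError ε m ≤
      ∑ m' ∈ univ.erase m, bhatt q ε n (enc m) (enc m') := by
  choose dec hdec using fun y => Finite.exists_max fun m => channelN q ε n (enc m) y
  refine ⟨dec, fun m => ?_⟩
  simp only [Code.msgError, bhatt]
  rw [sum_comm]
  refine sum_le_sum fun y _ => ?_
  split_ifs with h
  · exact sum_nonneg fun _ _ => Real.sqrt_nonneg _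
  · have hterm : channelN q ε n (enc m) y ≤
        √(channelN q ε n (enc m) y * channelN q ε n (enc (dec y)) y) :=
      Real.le_sqrt_of_sq_le <| (sq _).trans_le <|
        mul_le_mul_of_nonneg_left (hdec y m) (channelN_nonneg h0 h1 _ _)
    exact hterm.trans <| single_le_sum
      (f := fun m' => √(channelN q ε n (enc m) y * channelN q ε n (enc m') y))
      (fun _ _ => Real.sqrt_nonneg _) (mem_erase.2 ⟨h, mem_univ _⟩)

theorem exists_code_msgError_le_of_sum_bhatt_le {T : Type*} [Fintype T] [DecidableEq T] {M n : ℕ}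
    [NeZero M] (h0 : 0 ≤ ε) (h1 : ε ≤ 1) (hM : M ≤ Fintype.card T) {word : T → Fin n → ZMod q}
    {S : ℝ} (hS : ∀ t, ∑ t' ∈ univ.erase t, bhatt q ε n (word t) (word t') ≤ S) :
    ∃ C : Code q M n, ∀ m, C.msgError ε m ≤ S := by
  obtain ⟨e⟩ := Function.Embedding.nonempty_of_card_le ((Fintype.card_fin M).trans_le hM)
  obtain ⟨dec, hdec⟩ := exists_dec_msgError_le_sum_bhatt h0 h1 fun m => word (e m)
  refine ⟨⟨_, dec⟩, fun m => (hdec m).trans (le_trans ?_ (hS (e m)))⟩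
  rw [← sum_map _ e fun t => bhatt q ε n (word (e m)) (word t), map_erase]
  exact sum_le_sum_of_subset_of_nonneg (erase_subset_erase _ (subset_univ _))
    fun _ _ _ => bhatt_nonneg _ _

end Channel

section CycleKernel

variable {q : ℕ}

/-- The function `δ₀ + a (δ₁ + δ₋₁)` on `ℤ/qℤ`. With `a = α_ε`, its value at `y - x` is the
one-letter Bhattacharyya coefficient of the inputs `x` and `y` of the typewriter channel. Writing
it as a sum of indicators keeps that true for `q = 2`, where `1 = -1`. -/
noncomputable def cycleKernel (q : ℕ) (a : ℝ) (d : ZMod q) : ℝ :=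
  (if d = 0 then 1 else 0) + a * ((if d = 1 then 1 else 0) + if d = -1 then 1 else 0)

theorem cycleKernel_zero [Nontrivial (ZMod q)] (a : ℝ) : cycleKernel q a 0 = 1 := by
  simp [cycleKernel]

theorem cycleKernel_nonneg {a : ℝ} (ha : 0 ≤ a) (d : ZMod q) : 0 ≤ cycleKernel q a d := by
  unfold cycleKernel
  positivity

theorem cycleKernel_mono {a b : ℝ} (hab : a ≤ b) (d : ZMod q) :
    cycleKernel q a d ≤ cycleKernel q b d := by
  unfold cycleKernel
  gcongr

theorem cycleKernel_rpow (hq : 2 < q) (a : ℝ) {s : ℝ} (hs : s ≠ 0) (d : ZMod q) :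
    cycleKernel q a d ^ s = cycleKernel q (a ^ s) d := by
  have : Fact (1 < q) := ⟨by omega⟩
  have : Fact (2 < q) := ⟨hq⟩
  have h1 : (1 : ZMod q) ≠ -1 := (ZMod.neg_one_ne_one (n := q)).symm
  unfold cycleKernel
  split_ifs <;> simp_all

theorem sum_cycleKernel_mul [NeZero q] (a : ℝ) (f : ZMod q → ℝ) :
    ∑ d, cycleKernel q a d * f d = f 0 + a * (f 1 + f (-1)) := by
  simp [cycleKernel, add_mul, sum_add_distrib, mul_assoc, ← mul_sum]

theorem sum_sqrt_channel_mul_channel [NeZero q] [Nontrivial (ZMod q)] {ε : ℝ} (h0 : 0 ≤ ε)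
    (h1 : ε ≤ 1) (x y : ZMod q) :
    ∑ z, √(channel q ε x z * channel q ε y z) = cycleKernel q (alpha ε) (y - x) := by
  have hε : √ε * √ε = ε := Real.mul_self_sqrt h0
  have hε' : √(1 - ε) * √(1 - ε) = 1 - ε := Real.mul_self_sqrt (by linarith)
  have hα : √(1 - ε) * √ε = alpha ε := by rw [alpha, Real.sqrt_mul h0, mul_comm]
  calc ∑ z, √(channel q ε x z * channel q ε y z)
      = ∑ z, √(channel q ε x z) * √(channel q ε y z) := by
        simp only [Real.sqrt_mul (channel_nonneg h0 h1 x _)]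
    _ = √(1 - ε) * √(channel q ε y x) + √ε * √(channel q ε y (x + 1)) := by
        simp [sqrt_channel x, add_mul, sum_add_distrib]
    _ = (if x = y then √(1 - ε) * √(1 - ε) else 0) + (if x = y + 1 then √(1 - ε) * √ε else 0) +
          ((if x + 1 = y then √ε * √(1 - ε) else 0) + if x = y then √ε * √ε else 0) := by
        simp [sqrt_channel y, mul_add]
    _ = cycleKernel q (alpha ε) (y - x) := by
        have hself : y - x = 0 ↔ x = y := by rw [sub_eq_zero, eq_comm]
        have hsucc : y - x = 1 ↔ x + 1 = y := by rw [sub_eq_iff_eq_add', eq_comm]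
        have hpred : y - x = -1 ↔ x = y + 1 := by
          rw [← neg_sub, neg_inj, sub_eq_iff_eq_add']
        rw [hε, hε', mul_comm √ε, hα, cycleKernel]
        simp only [hself, hsucc, hpred]
        split_ifs <;> ring

theorem bhatt_eq_prod_cycleKernel [NeZero q] [Nontrivial (ZMod q)] {ε : ℝ} (h0 : 0 ≤ ε)
    (h1 : ε ≤ 1) {n : ℕ} (x y : Fin n → ZMod q) :
    bhatt q ε n x y = ∏ i, cycleKernel q (alpha ε) (y i - x i) := by
  simp_rw [← sum_sqrt_channel_mul_channel h0 h1, Fintype.prod_sum, bhatt, channelN,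
    ← prod_mul_distrib]
  exact sum_congr rfl fun z _ => Real.sqrt_prod _ fun i _ =>
    mul_nonneg (channel_nonneg h0 h1 _ _) (channel_nonneg h0 h1 _ _)

theorem bhatt_self [NeZero q] [Nontrivial (ZMod q)] {ε : ℝ} (h0 : 0 ≤ ε) (h1 : ε ≤ 1) {n : ℕ}
    (x : Fin n → ZMod q) : bhatt q ε n x x = 1 := by
  simp [bhatt_eq_prod_cycleKernel h0 h1, cycleKernel_zero]

end CycleKernel

section QuadraticForm

theorem pow_le_sum_sum_prod_kernel {X T : Type*} [Fintype X] [Fintype T] {K : X → X → ℝ}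
    {w : T → ℝ} {B : T → X → ℝ} (hw : ∀ t, 0 ≤ w t)
    (hK : ∀ x y, K x y = ∑ t, w t * (B t x * B t y)) {t₀ : T} (hB : ∀ x, B t₀ x = 1) {k : ℕ}
    {P : (Fin k → X) → ℝ} (hP : ∑ x, P x = 1) :
    w t₀ ^ k ≤ ∑ x, ∑ y, P x * P y * ∏ i, K (x i) (y i) := by
  classical
  have hsquares : ∑ x, ∑ y, P x * P y * ∏ i, K (x i) (y i) =
      ∑ t : Fin k → T, (∏ i, w (t i)) * (∑ x, P x * ∏ i, B (t i) (x i)) ^ 2 := by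
    simp_rw [hK, Fintype.prod_sum, sq, sum_mul_sum, mul_sum]
    rw [sum_comm (s := (univ : Finset (Fin k → T)))]
    refine sum_congr rfl fun x _ => ?_
    rw [sum_comm]
    refine sum_congr rfl fun t _ => sum_congr rfl fun y _ => ?_
    rw [prod_mul_distrib, prod_mul_distrib]
    ring
  calc w t₀ ^ k
      = (∏ _i : Fin k, w t₀) * (∑ x, P x * ∏ i, B t₀ (x i)) ^ 2 := by simp [hB, hP]
    _ ≤ ∑ t : Fin k → T, (∏ i, w (t i)) * (∑ x, P x * ∏ i, B (t i) (x i)) ^ 2 :=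
        single_le_sum (f := fun t : Fin k → T =>
            (∏ i, w (t i)) * (∑ x, P x * ∏ i, B (t i) (x i)) ^ 2)
          (fun t _ => mul_nonneg (prod_nonneg fun i _ => hw _) (sq_nonneg _))
          (mem_univ fun _ => t₀)
    _ = ∑ x, ∑ y, P x * P y * ∏ i, K (x i) (y i) := hsquares.symm

variable {q : ℕ} [NeZero q]

/-- The Fourier coefficient `1 + 2 a cos (2 π k / q)` of `cycleKernel q a`, that is, the eigenvalue
of the kernel `cycleKernel q a (y - x)` at the `k`-th character of `ℤ/qℤ`. -/
noncomputable def cycleEigenvalue (q : ℕ) [NeZero q] (a : ℝ) (k : ZMod q) : ℝ :=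
  1 + 2 * a * (ZMod.stdAddChar k).re

theorem cycleEigenvalue_zero (a : ℝ) : cycleEigenvalue q a 0 = 1 + 2 * a := by
  simp [cycleEigenvalue]

theorem sum_re_stdAddChar_mul (d : ZMod q) :
    ∑ k : ZMod q, (ZMod.stdAddChar (k * d)).re = if d = 0 then (q : ℝ) else 0 := by
  rw [← Complex.re_sum, AddChar.sum_mulShift d (ZMod.isPrimitive_stdAddChar q), ZMod.card]
  split_ifs <;> simp

theorem re_stdAddChar_add (x y : ZMod q) :
    (ZMod.stdAddChar (x + y)).re = (ZMod.stdAddChar x).re * (ZMod.stdAddChar y).re -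
      (ZMod.stdAddChar x).im * (ZMod.stdAddChar y).im := by
  rw [AddChar.map_add_eq_mul, Complex.mul_re]

theorem re_stdAddChar_neg (x : ZMod q) :
    (ZMod.stdAddChar (-x)).re = (ZMod.stdAddChar x).re := by
  rw [AddChar.map_neg_eq_conj, Complex.conj_re]

theorem im_stdAddChar_neg (x : ZMod q) :
    (ZMod.stdAddChar (-x)).im = -(ZMod.stdAddChar x).im := by
  rw [AddChar.map_neg_eq_conj, Complex.conj_im]

theorem two_mul_re_stdAddChar_mul (x y : ZMod q) :
    2 * ((ZMod.stdAddChar x).re * (ZMod.stdAddChar y).re) =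
      (ZMod.stdAddChar (y - x)).re + (ZMod.stdAddChar (y + x)).re := by
  rw [sub_eq_add_neg, re_stdAddChar_add, re_stdAddChar_add, re_stdAddChar_neg, im_stdAddChar_neg]
  ring

theorem cycleKernel_eq_sum_cycleEigenvalue (a : ℝ) (d : ZMod q) :
    cycleKernel q a d =
      ∑ k, cycleEigenvalue q a k / q * (ZMod.stdAddChar (k * d)).re := by
  have hq : (q : ℝ) ≠ 0 := NeZero.ne _
  have hterm : ∀ k : ZMod q, cycleEigenvalue q a k / q * (ZMod.stdAddChar (k * d)).re =
      ((ZMod.stdAddChar (k * d)).re + a * ((ZMod.stdAddChar (k * (d - 1))).re +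
        (ZMod.stdAddChar (k * (d + 1))).re)) / q := fun k => by
    rw [mul_sub k, mul_add k, mul_one, ← two_mul_re_stdAddChar_mul, cycleEigenvalue]
    ring
  simp only [hterm, ← sum_div, sum_add_distrib, ← mul_sum, sum_re_stdAddChar_mul, cycleKernel,
    sub_eq_zero, add_eq_zero_iff_eq_neg]
  split_ifs <;> field_simp <;> ring

theorem pow_le_sum_sum_prod_cycleKernel {a : ℝ} (ha : ∀ k, 0 ≤ cycleEigenvalue q a k) {k : ℕ}
    {P : (Fin k → ZMod q) → ℝ} (hP : ∑ x, P x = 1) :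
    ((1 + 2 * a) / q) ^ k ≤ ∑ x, ∑ y, P x * P y * ∏ i, cycleKernel q a (y i - x i) := by
  have h := pow_le_sum_sum_prod_kernel (K := fun x y => cycleKernel q a (y - x))
    (w := fun t : ZMod q × Bool => cycleEigenvalue q a t.1 / q)
    (B := fun t x => cond t.2 (ZMod.stdAddChar (t.1 * x)).re (ZMod.stdAddChar (t.1 * x)).im)
    (t₀ := (0, true)) (fun t => div_nonneg (ha t.1) q.cast_nonneg) (fun x y => by
      rw [cycleKernel_eq_sum_cycleEigenvalue, Fintype.sum_prod_type]
      refine sum_congr rfl fun j _ => ?_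
      rw [mul_sub, sub_eq_add_neg, re_stdAddChar_add, re_stdAddChar_neg, im_stdAddChar_neg,
        Fintype.sum_bool, cond_true, cond_true, cond_false, cond_false]
      ring) (fun x => by simp) hP
  simpa only [cycleEigenvalue_zero] using h

theorem neg_cos_pi_div_le_re_stdAddChar (hq : Odd q) (k : ZMod q) :
    -Real.cos (Real.pi / q) ≤ (ZMod.stdAddChar k).re := by
  have hq0 : (0 : ℝ) < q := by exact_mod_cast NeZero.pos q
  have hre : (ZMod.stdAddChar k).re = -Real.cos (Real.pi * |2 * (k.val : ℝ) - q| / q) := by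
    have habs : Real.pi * |2 * (k.val : ℝ) - q| / q = |Real.pi * (2 * k.val - q) / q| := by
      rw [abs_div, abs_mul, abs_of_pos Real.pi_pos, abs_of_pos hq0]
    rw [habs, Real.cos_abs, mul_sub, sub_div, mul_div_cancel_right₀ _ hq0.ne', Real.cos_sub_pi,
      neg_neg]
    have hk : ((k.val : ℤ) : ZMod q) = k := by simp
    nth_rewrite 1 [← hk]
    rw [ZMod.stdAddChar_coe, ← Complex.exp_ofReal_mul_I_re]
    congr 2
    push_cast
    ring
  have hlower : (1 : ℝ) ≤ |2 * (k.val : ℝ) - q| := by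
    have hne : 2 * (k.val : ℤ) - q ≠ 0 := by
      obtain ⟨r, hr⟩ := hq
      omega
    exact_mod_cast Int.one_le_abs hne
  have hupper : |2 * (k.val : ℝ) - q| ≤ q := by
    have hk : (k.val : ℝ) ≤ q := by exact_mod_cast k.val_lt.le
    have hk0 : (0 : ℝ) ≤ k.val := k.val.cast_nonneg
    exact abs_le.2 ⟨by linarith [hk0], by linarith [hk]⟩
  rw [hre, neg_le_neg_iff]
  have hpi := Real.pi_pos
  apply Real.cos_le_cos_of_nonneg_of_le_pi (by positivity)
  · rw [div_le_iff₀ hq0]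
    gcongr
  · gcongr
    exact le_mul_of_one_le_right hpi.le hlower

theorem cycleEigenvalue_nonneg (hq : Odd q) {a : ℝ} (ha0 : 0 ≤ a)
    (ha : 2 * a * Real.cos (Real.pi / q) ≤ 1) (k : ZMod q) : 0 ≤ cycleEigenvalue q a k := by
  have := mul_le_mul_of_nonneg_left (neg_cos_pi_div_le_re_stdAddChar hq k)
    (mul_nonneg two_pos.le ha0)
  rw [cycleEigenvalue]
  linarith

end QuadraticForm

section Expurgated

variable {q : ℕ} {ε ρ : ℝ}

theorem alpha_nonneg (ε : ℝ) : 0 ≤ alpha ε :=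
  Real.sqrt_nonneg _

theorem alpha_pos (h0 : 0 < ε) (h1 : ε < 1) : 0 < alpha ε :=
  Real.sqrt_pos.2 (mul_pos h0 (sub_pos.2 h1))

/-- The value `-ρ log₂ Q(ρ, P) - ρ R` of the single-letter expurgated objective at the uniform
distribution `P` on `ℤ/qℤ`, for which `Q(ρ, P) = (1 + 2 α_ε^{1/ρ}) / q` as soon as `q ≥ 3`. -/
noncomputable def uniformExponent (q : ℕ) (ε R ρ : ℝ) : ℝ :=
  ρ * (Real.logb 2 q - Real.logb 2 (1 + 2 * alpha ε ^ (1 / ρ)) - R)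

theorem continuousOn_uniformExponent (h0 : 0 < ε) (h1 : ε < 1) (R : ℝ) :
    ContinuousOn (uniformExponent q ε R) (Set.Ioi 0) := by
  have hα : 0 < alpha ε := alpha_pos h0 h1
  have hinv : ContinuousOn (fun ρ : ℝ => 1 / ρ) (Set.Ioi 0) :=
    continuousOn_const.div continuousOn_id fun ρ hρ => (Set.mem_Ioi.1 hρ).ne'
  have hpow : ContinuousOn (fun ρ : ℝ => alpha ε ^ (1 / ρ)) (Set.Ioi 0) :=
    continuousOn_const.rpow hinv fun _ _ => Or.inl hα.ne'
  have hne : ∀ ρ : ℝ, 1 + 2 * alpha ε ^ (1 / ρ) ≠ 0 := fun ρ => by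
    positivity
  have hlogb : ContinuousOn (fun ρ : ℝ => Real.logb 2 (1 + 2 * alpha ε ^ (1 / ρ))) (Set.Ioi 0) :=
    ((continuousOn_const.add (continuousOn_const.mul hpow)).log fun ρ _ => hne ρ).div_const _
  exact continuousOn_id.mul ((continuousOn_const.sub hlogb).sub continuousOn_const)

theorem half_lt_cos_pi_div (hq : 3 < q) : 1 / 2 < Real.cos (Real.pi / q) := by
  have hq' : (3 : ℝ) < q := by exact_mod_cast hq
  have hpi := Real.pi_pos
  rw [← Real.cos_pi_div_three]
  apply Real.cos_lt_cos_of_nonneg_of_le_pi (by positivity)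
  · linarith
  · gcongr

theorem le_log_div_log_of_rpow_one_div_le {x g : ℝ} (hx : 0 < x) (hg0 : 0 < g) (hg1 : g < 1)
    (hρ : 0 < ρ) (h : x ^ (1 / ρ) ≤ g) : ρ ≤ Real.log x / Real.log g := by
  have hlog := Real.log_le_log (by positivity) h
  rw [Real.log_rpow hx, one_div, inv_mul_le_iff₀ hρ] at hlog
  exact (le_div_iff_of_neg (Real.log_neg hg0 hg1)).2 hlog

variable [NeZero q]

theorem quadForm_eq_sum_prod_cycleKernel (hq : 2 < q) (h0 : 0 ≤ ε) (h1 : ε ≤ 1) (hρ : ρ ≠ 0)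
    (k : ℕ) (P : (Fin k → ZMod q) → ℝ) :
    quadForm q ε k ρ P =
      ∑ x, ∑ y, P x * P y * ∏ i, cycleKernel q (alpha ε ^ (1 / ρ)) (y i - x i) := by
  have : Fact (1 < q) := ⟨by omega⟩
  simp only [quadForm, bhatt_eq_prod_cycleKernel h0 h1,
    ← cycleKernel_rpow hq _ (one_div_ne_zero hρ),
    Real.finsetProd_rpow _ _ fun _ _ => cycleKernel_nonneg (alpha_nonneg ε) _]

theorem pow_le_quadForm (hq : Odd q) (hq2 : 2 < q) (h0 : 0 ≤ ε) (h1 : ε ≤ 1) (hρ : ρ ≠ 0) {a : ℝ}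
    (ha0 : 0 ≤ a) (ha : 2 * a * Real.cos (Real.pi / q) ≤ 1) (haα : a ≤ alpha ε ^ (1 / ρ)) (k : ℕ)
    (P : stdSimplex ℝ (Fin k → ZMod q)) :
    ((1 + 2 * a) / q) ^ k ≤ quadForm q ε k ρ P.1 := by
  rw [quadForm_eq_sum_prod_cycleKernel hq2 h0 h1 hρ]
  refine (pow_le_sum_sum_prod_cycleKernel (cycleEigenvalue_nonneg hq ha0 ha) P.2.2).trans ?_
  gcongr with x _ y _ i _
  · exact mul_nonneg (P.2.1 x) (P.2.1 y)
  · exact fun i _ => cycleKernel_nonneg ha0 _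
  · exact cycleKernel_mono haα _

theorem exFun_le (hq : Odd q) (hq2 : 2 < q) (h0 : 0 ≤ ε) (h1 : ε ≤ 1) (hρ : 0 < ρ) {a : ℝ}
    (ha0 : 0 ≤ a) (ha : 2 * a * Real.cos (Real.pi / q) ≤ 1) (haα : a ≤ alpha ε ^ (1 / ρ)) {k : ℕ}
    (hk : 1 ≤ k) :
    exFun q ε k ρ ≤ ρ * (Real.logb 2 q - Real.logb 2 (1 + 2 * a)) := by
  have : (0 : ℝ) < k := by exact_mod_cast hk
  have hq0 : (0 : ℝ) < q := by exact_mod_cast NeZero.pos q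
  have hlogb : k * (Real.logb 2 (1 + 2 * a) - Real.logb 2 q) ≤
      Real.logb 2 (⨅ P : stdSimplex ℝ (Fin k → ZMod q), quadForm q ε k ρ P.1) := by
    rw [← Real.logb_div (by positivity) hq0.ne', ← Real.logb_pow]
    exact Real.logb_le_logb_of_le one_lt_two (by positivity)
      (le_ciInf fun P => pow_le_quadForm hq hq2 h0 h1 hρ.ne' ha0 ha haα k P)
  calc exFun q ε k ρ
      ≤ -(ρ / k) * (k * (Real.logb 2 (1 + 2 * a) - Real.logb 2 q)) :=
        mul_le_mul_of_nonpos_left hlogb (neg_nonpos.2 (by positivity))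
    _ = ρ * (Real.logb 2 q - Real.logb 2 (1 + 2 * a)) := by
        field_simp
        ring

theorem exFun_sub_le_uniformExponent (hq : Odd q) (hq2 : 2 < q) (h0 : 0 ≤ ε) (h1 : ε ≤ 1)
    (hρ : 0 < ρ) (hα : 2 * alpha ε ^ (1 / ρ) * Real.cos (Real.pi / q) ≤ 1) {k : ℕ} (hk : 1 ≤ k)
    (R : ℝ) : exFun q ε k ρ - ρ * R ≤ uniformExponent q ε R ρ := by
  rw [uniformExponent, mul_sub ρ _ R]
  gcongr
  exact exFun_le hq hq2 h0 h1 hρ (Real.rpow_nonneg (alpha_nonneg ε) _) hα le_rfl hk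

theorem exFun_sub_nonpos (hq : Odd q) (hq3 : 3 < q) (h0 : 0 ≤ ε) (h1 : ε ≤ 1) (hρ : 0 < ρ)
    (hα : 1 ≤ 2 * alpha ε ^ (1 / ρ) * Real.cos (Real.pi / q)) {k : ℕ} (hk : 1 ≤ k) {R : ℝ}
    (hR : Real.logb 2 q - Real.logb 2 (1 + 1 / Real.cos (Real.pi / q)) ≤ R) :
    exFun q ε k ρ - ρ * R ≤ 0 := by
  have hcos : 0 < Real.cos (Real.pi / q) := one_half_pos.trans (half_lt_cos_pi_div hq3)
  have hle : 1 / Real.cos (Real.pi / q) / 2 ≤ alpha ε ^ (1 / ρ) := by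
    rw [div_le_iff₀ two_pos, div_le_iff₀ hcos]
    linarith
  have hex := exFun_le hq (by omega) h0 h1 hρ (a := 1 / Real.cos (Real.pi / q) / 2)
    (by positivity) (by field_simp; rfl) hle hk
  rw [mul_div_cancel₀ _ (two_ne_zero' ℝ)] at hex
  exact sub_nonpos.2 (hex.trans (mul_le_mul_of_nonneg_left hR hρ.le))

/- Once `α_ε^{1/ρ}` leaves the range where the kernel is positive semidefinite, the contribution of
`ρ` is nonpositive. This leaves a compact interval of `ρ`, on which the supremum is attained. -/
theorem expurgatedInf_lt (hq : Odd q) (hq3 : 3 < q) (h0 : 0 < ε) (h1 : ε < 1) {R v : ℝ}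
    (hR : Real.logb 2 q - Real.logb 2 (1 + 1 / Real.cos (Real.pi / q)) ≤ R) (hv0 : 0 < v)
    (hv : ∀ ρ, 1 ≤ ρ → uniformExponent q ε R ρ < v) :
    expurgatedInf q ε R < v := by
  have hcos := half_lt_cos_pi_div hq3
  set c := Real.cos (Real.pi / q)
  have hc : 0 < 2 * c := by linarith
  set r := Real.log (alpha ε) / Real.log (1 / (2 * c))
  have hr : ∀ ρ, 0 < ρ → 2 * alpha ε ^ (1 / ρ) * c ≤ 1 → ρ ≤ r := fun ρ hρ h =>
    le_log_div_log_of_rpow_one_div_le (alpha_pos h0 h1) (one_div_pos.2 hc)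
      ((div_lt_one hc).2 (by linarith)) hρ ((le_div_iff₀ hc).2 (by linarith))
  obtain ⟨ρ₀, hρ₀, hmax⟩ := (isCompact_Icc (a := 1) (b := max 1 r)).exists_isMaxOn
    ⟨1, le_rfl, le_max_left 1 r⟩
    ((continuousOn_uniformExponent (q := q) h0 h1 R).mono fun ρ hρ => zero_lt_one.trans_le hρ.1)
  have hbound : expurgatedInf q ε R ≤ (max (uniformExponent q ε R ρ₀) 0 : ℝ) := by
    refine iSup₂_le fun k hk => iSup₂_le fun ρ hρ => EReal.coe_le_coe_iff.2 ?_
    have hρ0 : 0 < ρ := by linarith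
    rcases le_total (2 * alpha ε ^ (1 / ρ) * c) 1 with h | h
    · exact le_max_of_le_left <|
        (exFun_sub_le_uniformExponent hq (by omega) h0.le h1.le hρ0 h hk R).trans
          (hmax ⟨hρ, (hr ρ hρ0 h).trans (le_max_right 1 r)⟩)
    · exact le_max_of_le_right (exFun_sub_nonpos hq hq3 h0.le h1.le hρ0 h hk hR)
  exact hbound.trans_lt (EReal.coe_lt_coe_iff.2 (max_lt (hv ρ₀ hρ₀.1) hv0))

end Expurgated

section Entropy

variable {q : ℕ} {δ b : ℝ}

theorem entropy_add_mul_logb (hq : 2 ≤ q) (hδ0 : 0 < δ) (hb : 0 < b) :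
    entropy q δ + δ * Real.logb 2 b =
      (δ * Real.log ((q - 1) * b / δ) + (1 - δ) * Real.log (1 / (1 - δ))) / Real.log 2 := by
  have hq1 : (0 : ℝ) < q - 1 := sub_pos.2 (by exact_mod_cast hq)
  rw [Real.log_div (by positivity) hδ0.ne', Real.log_mul hq1.ne' hb.ne', one_div, entropy,
    Real.qaryEntropy, Real.binEntropy, Real.log_inv, Real.log_inv, Real.logb]
  push_cast
  ring

theorem entropy_add_mul_logb_eq (hq : 2 ≤ q) (hδ0 : 0 < δ) (hδ1 : δ < 1) (hb : 0 < b)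
    (h : (q - 1) * b * (1 - δ) = δ) :
    entropy q δ + δ * Real.logb 2 b = Real.logb 2 (1 + (q - 1) * b) := by
  have hδ : 0 < 1 - δ := sub_pos.2 hδ1
  have hx : (q - 1) * b / δ = 1 + (q - 1) * b := by
    rw [div_eq_iff hδ0.ne']
    linear_combination h
  have hy : 1 / (1 - δ) = 1 + (q - 1) * b := by
    rw [div_eq_iff hδ.ne']
    linear_combination -h
  rw [entropy_add_mul_logb hq hδ0 hb, hx, hy, Real.logb]
  ring

theorem entropy_add_mul_logb_lt (hq : 2 ≤ q) (hδ0 : 0 < δ) (hδ1 : δ < 1) (hb : 0 < b)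
    (h : (q - 1) * b * (1 - δ) ≠ δ) :
    entropy q δ + δ * Real.logb 2 b < Real.logb 2 (1 + (q - 1) * b) := by
  have hq1 : (0 : ℝ) < q - 1 := sub_pos.2 (by exact_mod_cast hq)
  have hδ : 0 < 1 - δ := sub_pos.2 hδ1
  have hne : (q - 1) * b / δ ≠ 1 / (1 - δ) := fun h' =>
    h ((div_eq_div_iff hδ0.ne' hδ.ne').1 h' |>.trans (one_mul δ))
  have hmean : δ * ((q - 1) * b / δ) + (1 - δ) * (1 / (1 - δ)) = 1 + (q - 1) * b := by
    field_simp
    ring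
  have hx : 0 < (q - 1) * b / δ := by positivity
  have hconcave := strictConcaveOn_log_Ioi.2 (Set.mem_Ioi.2 hx) (Set.mem_Ioi.2 (one_div_pos.2 hδ))
    hne hδ0 hδ (add_sub_cancel δ 1)
  rw [smul_eq_mul, smul_eq_mul, smul_eq_mul, smul_eq_mul, hmean] at hconcave
  rw [entropy_add_mul_logb hq hδ0 hb, Real.logb]
  exact div_lt_div_of_pos_right hconcave (Real.log_pos one_lt_two)

theorem entropy_add_mul_logb_le (hq : 2 ≤ q) (hδ0 : 0 < δ) (hδ1 : δ < 1) (hb : 0 < b) :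
    entropy q δ + δ * Real.logb 2 b ≤ Real.logb 2 (1 + (q - 1) * b) := by
  by_cases h : (q - 1) * b * (1 - δ) = δ
  exacts [(entropy_add_mul_logb_eq hq hδ0 hδ1 hb h).le,
    (entropy_add_mul_logb_lt hq hδ0 hδ1 hb h).le]

theorem entropy_zero (q : ℕ) : entropy q 0 = 0 := by
  simp [entropy]

theorem entropy_one_sub_inv (hq : 2 ≤ q) : entropy q (1 - 1 / q) = Real.logb 2 q := by
  have hq' : (2 : ℝ) ≤ q := by exact_mod_cast hq
  have h := entropy_add_mul_logb_eq (δ := 1 - 1 / (q : ℝ)) (b := 1) hq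
    (sub_pos.2 ((div_lt_one (by linarith)).2 (by linarith)))
    (sub_lt_self 1 (by positivity)) one_pos (by field_simp; ring)
  simpa using h

theorem continuous_entropy (q : ℕ) : Continuous (entropy q) :=
  Real.qaryEntropy_continuous.div_const _

theorem strictMonoOn_entropy (hq : 2 ≤ q) :
    StrictMonoOn (entropy q) (Set.Icc 0 (1 - 1 / (q : ℝ))) := fun _ hx _ hy hxy =>
  div_lt_div_of_pos_right (Real.qaryEntropy_strictMonoOn hq hx hy hxy) (Real.log_pos one_lt_two)

theorem deltaGV_mem_Icc_and_entropy_deltaGV (hq : 2 ≤ q) {r : ℝ} (hr0 : 0 ≤ r)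
    (hr : r ≤ Real.logb 2 q) :
    deltaGV r q ∈ Set.Icc 0 (1 - 1 / (q : ℝ)) ∧
      entropy q (deltaGV r q) = Real.logb 2 q - r := by
  have hq' : (1 : ℝ) ≤ q := by exact_mod_cast one_le_two.trans hq
  have hle : (0 : ℝ) ≤ 1 - 1 / q := sub_nonneg.2 ((div_le_one (by linarith)).2 hq')
  obtain ⟨δ, hδ, hent⟩ := intermediate_value_Icc hle (continuous_entropy q).continuousOn
    (show Real.logb 2 q - r ∈ Set.Icc (entropy q 0) (entropy q (1 - 1 / q)) by
      rw [entropy_zero, entropy_one_sub_inv hq]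
      exact ⟨by linarith, by linarith⟩)
  have hset : {x : ℝ | 0 ≤ x ∧ x ≤ 1 - 1 / (q : ℝ) ∧ r = Real.logb 2 q - entropy q x} = {δ} := by
    refine Set.eq_singleton_iff_unique_mem.2 ⟨⟨hδ.1, hδ.2, by linarith⟩, ?_⟩
    rintro x ⟨hx0, hx1, hx⟩
    exact (strictMonoOn_entropy hq).injOn ⟨hx0, hx1⟩ hδ (by linarith)
  rw [deltaGV, hset, csSup_singleton]
  exact ⟨hδ, hent⟩

end Entropy

section Family

theorem sum_rpow_le_rpow_sum {ι : Type*} (s : Finset ι) {f : ι → ℝ} (hf : ∀ i ∈ s, 0 ≤ f i)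
    {ρ : ℝ} (hρ : 1 ≤ ρ) : ∑ i ∈ s, f i ^ ρ ≤ (∑ i ∈ s, f i) ^ ρ := by
  induction s using Finset.cons_induction with
  | empty => simpa using Real.rpow_nonneg le_rfl ρ
  | cons i s hi ih =>
    rw [forall_mem_cons] at hf
    rw [sum_cons, sum_cons]
    exact (add_le_add_right (ih hf.2) _).trans
      (Real.add_rpow_le_rpow_add hf.1 (sum_nonneg hf.2) hρ)

variable {J : Type*} [Fintype J] [DecidableEq J]

theorem sum_sum_erase {w : J → J → ℝ} (hw : ∀ i k, w i k = w k i) (j : J) :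
    ∑ i, ∑ k ∈ univ.erase i, w i k = 2 * ∑ k ∈ univ.erase j, w j k +
      ∑ i ∈ univ.erase j, ∑ k ∈ (univ.erase i).erase j, w i k := by
  have hrow : ∀ i ∈ univ.erase j, ∑ k ∈ univ.erase i, w i k =
      w j i + ∑ k ∈ (univ.erase i).erase j, w i k := fun i hi => by
    rw [hw j i, add_sum_erase _ _ (mem_erase.2 ⟨(ne_of_mem_erase hi).symm, mem_univ j⟩)]
  rw [← add_sum_erase univ _ (mem_univ j), sum_congr rfl hrow, sum_add_distrib]
  ring

/- A family minimizing the total energy `∑ f (c j) (c k)` works: moving its point `c j` to a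
uniformly random place does not lower the energy, so the energy at `c j` is at most average. -/
theorem exists_family_sum_le {V : Type*} [Fintype V] [Nonempty V] {f : V → V → ℝ}
    (hf : ∀ u v, f u v = f v u) {A : ℝ} (hA : ∀ u, ∑ v, f v u ≤ Fintype.card V * A) :
    ∃ c : J → V, ∀ j, ∑ k ∈ univ.erase j, f (c j) (c k) ≤ (Fintype.card J - 1) * A := by
  obtain ⟨c, hc⟩ := Finite.exists_min fun c : J → V => ∑ i, ∑ k ∈ univ.erase i, f (c i) (c k)
  refine ⟨c, fun j => ?_⟩
  have hmove : ∀ v, ∑ k ∈ univ.erase j, f (c j) (c k) ≤ ∑ k ∈ univ.erase j, f v (c k) := fun v => by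
    have hupdate : ∀ k, k ≠ j → Function.update c j v k = c k := fun k hk =>
      Function.update_of_ne hk _ _
    have hself : ∑ k ∈ univ.erase j, f v (Function.update c j v k) =
        ∑ k ∈ univ.erase j, f v (c k) :=
      sum_congr rfl fun k hk => by rw [hupdate k (ne_of_mem_erase hk)]
    have hrest : ∑ i ∈ univ.erase j, ∑ k ∈ (univ.erase i).erase j,
        f (Function.update c j v i) (Function.update c j v k) =
          ∑ i ∈ univ.erase j, ∑ k ∈ (univ.erase i).erase j, f (c i) (c k) :=
      sum_congr rfl fun i hi => sum_congr rfl fun k hk => by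
        rw [hupdate i (ne_of_mem_erase hi), hupdate k (ne_of_mem_erase hk)]
    have h := hc (Function.update c j v)
    rw [sum_sum_erase (fun _ _ => hf _ _) j, sum_sum_erase (fun _ _ => hf _ _) j,
      Function.update_self, hself, hrest] at h
    linarith
  have hcard : (#(univ.erase j) : ℝ) = Fintype.card J - 1 := by
    rw [card_erase_of_mem (mem_univ j), card_univ, Nat.cast_pred (Fintype.card_pos_iff.2 ⟨j⟩)]
  have hV : (0 : ℝ) < Fintype.card V := by exact_mod_cast Fintype.card_pos
  refine le_of_mul_le_mul_left ?_ hV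
  calc Fintype.card V * ∑ k ∈ univ.erase j, f (c j) (c k)
      = ∑ _v : V, ∑ k ∈ univ.erase j, f (c j) (c k) := by
        rw [sum_const, card_univ, nsmul_eq_mul]
    _ ≤ ∑ v, ∑ k ∈ univ.erase j, f v (c k) := sum_le_sum fun v _ => hmove v
    _ = ∑ k ∈ univ.erase j, ∑ v, f v (c k) := sum_comm
    _ ≤ ∑ _k ∈ univ.erase j, Fintype.card V * A := sum_le_sum fun k _ => hA _
    _ = Fintype.card V * ((Fintype.card J - 1) * A) := by
      rw [sum_const, nsmul_eq_mul, hcard]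
      ring

variable {ι A : Type*} [Fintype ι] [DecidableEq A]

theorem prod_ite_eq_pow_hammingDist (b : ℝ) (u v : ι → A) :
    ∏ i, (if u i = v i then 1 else b) = b ^ hammingDist u v := by
  rw [prod_ite, prod_const_one, one_mul, prod_const, hammingDist]

variable [Fintype A]

theorem sum_pow_hammingDist [DecidableEq ι] (b : ℝ) (u : ι → A) :
    ∑ v, b ^ hammingDist v u = (1 + (Fintype.card A - 1) * b) ^ Fintype.card ι := by
  have hletter (a : A) : ∑ y, (if y = a then 1 else b) = 1 + (Fintype.card A - 1) * b := by
    have hcard : (#(univ.erase a) : ℝ) = Fintype.card A - 1 := by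
      rw [card_erase_of_mem (mem_univ a), card_univ, Nat.cast_pred (Fintype.card_pos_iff.2 ⟨a⟩)]
    rw [← add_sum_erase univ _ (mem_univ a), if_pos rfl,
      sum_congr rfl fun y hy => if_neg (ne_of_mem_erase hy), sum_const, nsmul_eq_mul, hcard]
  simp_rw [← prod_ite_eq_pow_hammingDist]
  rw [← Fintype.prod_sum fun i y => if y = u i then (1 : ℝ) else b]
  simp only [hletter, prod_const, card_univ]

theorem exists_family_sum_pow_hammingDist_le [Nonempty A] {b ρ : ℝ} (hb : 0 ≤ b) (hρ : 1 ≤ ρ) :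
    ∃ c : J → ι → A, ∀ j, ∑ k ∈ univ.erase j, (b ^ ρ) ^ hammingDist (c j) (c k) ≤
      ((Fintype.card J - 1) *
        ((1 + (Fintype.card A - 1) * b) / Fintype.card A) ^ Fintype.card ι) ^ ρ := by
  classical
  have hA : (Fintype.card A : ℝ) ≠ 0 := by exact_mod_cast Fintype.card_ne_zero
  obtain ⟨c, hc⟩ := exists_family_sum_le (J := J) (V := ι → A)
    (f := fun u v => b ^ hammingDist u v)
    (A := ((1 + (Fintype.card A - 1) * b) / Fintype.card A) ^ Fintype.card ι)
    (fun u v => by rw [hammingDist_comm]) fun u => by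
      rw [sum_pow_hammingDist, Fintype.card_fun, div_pow, Nat.cast_pow,
        mul_div_cancel₀ _ (pow_ne_zero _ hA)]
  refine ⟨c, fun j => ?_⟩
  calc ∑ k ∈ univ.erase j, (b ^ ρ) ^ hammingDist (c j) (c k)
      = ∑ k ∈ univ.erase j, (b ^ hammingDist (c j) (c k)) ^ ρ :=
        sum_congr rfl fun k _ => by
          rw [← Real.rpow_mul_natCast hb, ← Real.rpow_natCast_mul hb, mul_comm]
    _ ≤ (∑ k ∈ univ.erase j, b ^ hammingDist (c j) (c k)) ^ ρ :=
        sum_rpow_le_rpow_sum _ (fun k _ => by positivity) hρ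
    _ ≤ _ := Real.rpow_le_rpow (sum_nonneg fun k _ => by positivity) (hc j) (by linarith)

theorem exists_one_le_rpow_eq {b β : ℝ} (hβ0 : 0 < β) (hβb : β ≤ b) (hb1 : b < 1) :
    ∃ ρ : ℝ, 1 ≤ ρ ∧ b ^ ρ = β := by
  have hb0 : 0 < b := hβ0.trans_le hβb
  have hlog : Real.log b < 0 := Real.log_neg hb0 hb1
  refine ⟨Real.log β / Real.log b,
    (one_le_div_of_neg hlog).2 (Real.log_le_log hβ0 hβb), ?_⟩
  rw [Real.rpow_def_of_pos hb0, mul_div_cancel₀ _ hlog.ne, Real.exp_log hβ0]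

theorem two_rpow_mul_div_eq_rpow {q : ℕ} (hq : 2 ≤ q) {δ b : ℝ} (hδ0 : 0 < δ) (hδ1 : δ < 1)
    (hb : 0 < b) (h : (q - 1) * b * (1 - δ) = δ) :
    2 ^ (Real.logb 2 q - entropy q δ) * ((1 + (q - 1) * b) / q) = b ^ δ := by
  have hq1 : (0 : ℝ) < q - 1 := sub_pos.2 (by exact_mod_cast hq)
  have hq0 : (0 : ℝ) < q := by linarith
  have hsum : 0 < 1 + (q - 1) * b := by positivity
  have hpow : ∀ x : ℝ, 0 < x → (2 : ℝ) ^ Real.logb 2 x = x := fun x hx =>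
    Real.rpow_logb two_pos (by norm_num) hx
  calc 2 ^ (Real.logb 2 q - entropy q δ) * ((1 + (q - 1) * b) / q)
      = 2 ^ (Real.logb 2 q - entropy q δ + Real.logb 2 ((1 + (q - 1) * b) / q)) := by
        rw [Real.rpow_add two_pos, hpow _ (div_pos hsum hq0)]
    _ = 2 ^ (Real.logb 2 b * δ) := by
        rw [Real.logb_div hsum.ne' hq0.ne', ← entropy_add_mul_logb_eq hq hδ0 hδ1 hb h]
        ring_nf
    _ = b ^ δ := by rw [Real.rpow_mul two_pos.le, hpow b hb]

theorem exists_family_sum_pow_hammingDist_le_rpow {q : ℕ} (hq : 2 ≤ q) (hA : Fintype.card A = q)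
    {δ β : ℝ} (hδ0 : 0 < δ) (hδ1 : δ ≤ 1 - 1 / q) (hβ0 : 0 < β) (hβ : (q - 1) * β * (1 - δ) ≤ δ)
    (hJ : (Fintype.card J : ℝ) <
      2 ^ ((Real.logb 2 q - entropy q δ) * Fintype.card ι) + 1) :
    ∃ c : J → ι → A, ∀ j, ∑ k ∈ univ.erase j, β ^ hammingDist (c j) (c k) ≤
      β ^ (δ * Fintype.card ι) := by
  have : Nonempty A := Fintype.card_pos_iff.1 (by omega)
  have hq2 : (2 : ℝ) ≤ q := by exact_mod_cast hq
  have hq1 : (0 : ℝ) < q - 1 := by linarith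
  rcases hδ1.eq_or_lt with rfl | hδ1
  · rw [entropy_one_sub_inv hq, sub_self, zero_mul, Real.rpow_zero] at hJ
    have : Subsingleton J := Fintype.card_le_one_iff_subsingleton.1 <|
      Nat.lt_succ_iff.1 (by exact_mod_cast hJ.trans_eq one_add_one_eq_two)
    refine ⟨fun _ _ => Classical.arbitrary A, fun j => ?_⟩
    rw [sum_eq_zero fun k hk => absurd (Subsingleton.elim k j) (ne_of_mem_erase hk)]
    positivity
  · have hδ : 1 / q < 1 - δ := by linarith
    have hδ' : 0 < 1 - δ := lt_trans (by positivity) hδ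
    set b := δ / ((q - 1) * (1 - δ)) with hb
    have hb0 : 0 < b := by positivity
    have hb1 : b < 1 := by
      rw [div_lt_iff₀ (by linarith)] at hδ
      rw [hb, div_lt_one (by positivity)]
      linarith
    have hβb : β ≤ b := by
      rw [hb, le_div_iff₀ (by positivity)]
      linarith
    have : 0 ≤ (1 + (q - 1) * b) / q := by positivity
    obtain ⟨ρ, hρ1, hbρ⟩ := exists_one_le_rpow_eq hβ0 hβb hb1
    obtain ⟨c, hc⟩ := exists_family_sum_pow_hammingDist_le (J := J) (ι := ι) (A := A) hb0.le hρ1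
    rw [hbρ, hA] at hc
    refine ⟨c, fun j => (hc j).trans ?_⟩
    have hJ1 : (1 : ℝ) ≤ Fintype.card J := by exact_mod_cast Fintype.card_pos_iff.2 ⟨j⟩
    calc ((Fintype.card J - 1) * ((1 + (q - 1) * b) / q) ^ Fintype.card ι) ^ ρ
        ≤ (2 ^ ((Real.logb 2 q - entropy q δ) * Fintype.card ι) *
            ((1 + (q - 1) * b) / q) ^ Fintype.card ι) ^ ρ := by
          refine Real.rpow_le_rpow (mul_nonneg (by linarith) (by positivity)) ?_ (by linarith)
          gcongr
          linarith
      _ = (b ^ (δ * Fintype.card ι)) ^ ρ := by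
          rw [Real.rpow_mul_natCast two_pos.le, ← mul_pow, Real.rpow_mul_natCast hb0.le,
            two_rpow_mul_div_eq_rpow hq hδ0 (by linarith) hb0 (by rw [hb]; field_simp)]
      _ = β ^ (δ * Fintype.card ι) := by
          rw [← hbρ, ← Real.rpow_mul hb0.le, ← Real.rpow_mul hb0.le, mul_comm]

end Family

section CosetCode

variable {ε : ℝ} {m : ℕ}

/-- The constant `α_ε (1 + α_ε)`: the total Bhattacharyya coefficient between a codeword
`(x, 2 x + u)` and all the words `(x', 2 x' + v)` with `x' ∈ ℤ/5ℤ`, for any `v ≠ u`. -/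
noncomputable def beta (ε : ℝ) : ℝ :=
  alpha ε * (1 + alpha ε)

/-- The codeword `(x, 2 x + u)` of length `2 m` over `ℤ/5ℤ`. For fixed `u`, these words form a coset
of the `m`-fold product of Shannon's zero-error code `{(x, 2 x)}` for the pentagon. -/
def cosetWord (u x : Fin m → ZMod 5) : Fin (m + m) → ZMod 5 :=
  Fin.append x (2 * x + u)

theorem sum_cycleKernel_mul_cycleKernel_two_mul_add (a : ℝ) (w : ZMod 5) :
    ∑ d, cycleKernel 5 a d * cycleKernel 5 a (2 * d + w) = if w = 0 then 1 else a * (1 + a) := by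
  rw [sum_cycleKernel_mul]
  obtain rfl | rfl | rfl | rfl | rfl : w = 0 ∨ w = 1 ∨ w = 2 ∨ w = 3 ∨ w = 4 := by
    revert w
    decide
  all_goals simp +decide [cycleKernel, mul_add, add_comm]

theorem sum_bhatt_cosetWord (h0 : 0 ≤ ε) (h1 : ε ≤ 1) (u v x : Fin m → ZMod 5) :
    ∑ x', bhatt 5 ε (m + m) (cosetWord u x) (cosetWord v x') = beta ε ^ hammingDist u v := by
  have : Fact (1 < 5) := ⟨by norm_num⟩
  have hterm : ∀ d, bhatt 5 ε (m + m) (cosetWord u x) (cosetWord v (d + x)) =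
      ∏ i, cycleKernel 5 (alpha ε) (d i) * cycleKernel 5 (alpha ε) (2 * d i + (v i - u i)) :=
    fun d => by
      rw [bhatt_eq_prod_cycleKernel h0 h1, Fin.prod_univ_add, ← prod_mul_distrib]
      refine prod_congr rfl fun i _ => ?_
      simp only [cosetWord, Fin.append_left, Fin.append_right, Pi.add_apply, Pi.mul_apply,
        Pi.ofNat_apply]
      ring_nf
  rw [← Equiv.sum_comp (Equiv.addRight x), ← prod_ite_eq_pow_hammingDist]
  simp only [Equiv.coe_addRight, hterm]
  rw [← Fintype.prod_sum fun i d =>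
    cycleKernel 5 (alpha ε) d * cycleKernel 5 (alpha ε) (2 * d + (v i - u i))]
  refine prod_congr rfl fun i _ => ?_
  rw [sum_cycleKernel_mul_cycleKernel_two_mul_add, beta]
  simp only [sub_eq_zero, eq_comm]

theorem sum_erase_bhatt_cosetWord {J : Type*} [Fintype J] [DecidableEq J] (h0 : 0 ≤ ε)
    (h1 : ε ≤ 1) (c : J → Fin m → ZMod 5) (t : J × (Fin m → ZMod 5)) :
    ∑ t' ∈ univ.erase t, bhatt 5 ε (m + m) (cosetWord (c t.1) t.2) (cosetWord (c t'.1) t'.2) =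
      ∑ k ∈ univ.erase t.1, beta ε ^ hammingDist (c t.1) (c k) := by
  have : Fact (1 < 5) := ⟨by norm_num⟩
  have hsum : ∑ t' : J × (Fin m → ZMod 5),
      bhatt 5 ε (m + m) (cosetWord (c t.1) t.2) (cosetWord (c t'.1) t'.2) =
        ∑ k, beta ε ^ hammingDist (c t.1) (c k) := by
    simp only [Fintype.sum_prod_type, sum_bhatt_cosetWord h0 h1]
  rw [← add_sum_erase univ _ (mem_univ t), ← add_sum_erase univ _ (mem_univ t.1),
    bhatt_self h0 h1, hammingDist_self, pow_zero] at hsum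
  exact add_left_cancel hsum

theorem exists_code_msgError_le_of_sum_pow_hammingDist_le {M N : ℕ} [NeZero M] (h0 : 0 ≤ ε)
    (h1 : ε ≤ 1) (hM : M ≤ 5 ^ m * N) {c : Fin N → Fin m → ZMod 5} {S : ℝ}
    (hS : ∀ j, ∑ k ∈ univ.erase j, beta ε ^ hammingDist (c j) (c k) ≤ S) :
    ∃ C : Code 5 M (m + m), ∀ μ, C.msgError ε μ ≤ S :=
  exists_code_msgError_le_of_sum_bhatt_le (T := Fin N × (Fin m → ZMod 5))
    (word := fun t => cosetWord (c t.1) t.2) h0 h1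
    (by simpa [ZMod.card, mul_comm] using hM)
    fun t => (sum_erase_bhatt_cosetWord h0 h1 c t).trans_le (hS t.1)

end CosetCode

section Five

variable {ε R : ℝ}

theorem alpha_le_half (ε : ℝ) : alpha ε ≤ 1 / 2 := by
  refine Real.sqrt_le_iff.2 ⟨by norm_num, ?_⟩
  linarith [sq_nonneg (ε - 1 / 2)]

theorem beta_pos (h0 : 0 < ε) (h1 : ε < 1) : 0 < beta ε :=
  mul_pos (alpha_pos h0 h1) (by linarith [alpha_nonneg ε])

theorem beta_nonneg (ε : ℝ) : 0 ≤ beta ε :=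
  mul_nonneg (alpha_nonneg ε) (by linarith [alpha_nonneg ε])

theorem beta_lt_one (ε : ℝ) : beta ε < 1 := by
  rw [beta]
  nlinarith [alpha_le_half ε, alpha_nonneg ε]

theorem one_add_four_mul_beta (ε : ℝ) : 1 + 4 * beta ε = (1 + 2 * alpha ε) ^ 2 := by
  rw [beta]
  ring

theorem logb_two_sqrt_five : Real.logb 2 √5 = Real.logb 2 5 / 2 := by
  rw [Real.logb, Real.log_sqrt (by norm_num), Real.logb]
  ring

theorem one_sub_inv_one_add_four_mul_beta_mem_Icc (ε : ℝ) :
    1 - 1 / (1 + 4 * beta ε) ∈ Set.Icc 0 (1 - 1 / ((5 : ℕ) : ℝ)) := by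
  have := beta_nonneg ε
  refine ⟨sub_nonneg.2 ((div_le_one (by positivity)).2 (by linarith)), ?_⟩
  push_cast
  gcongr
  linarith [beta_lt_one ε]

theorem entropy_one_sub_inv_one_add_four_mul_beta (ε : ℝ) :
    entropy 5 (1 - 1 / (1 + 4 * beta ε)) = 2 * (Real.logb 2 5 - RPlus5 ε) := by
  rw [RPlus5, one_add_four_mul_beta]
  ring

theorem RPlus5_le_logb_five (ε : ℝ) : RPlus5 ε ≤ Real.logb 2 5 := by
  have ht := one_sub_inv_one_add_four_mul_beta_mem_Icc ε
  have := (strictMonoOn_entropy (by norm_num)).monotoneOn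
    (Set.left_mem_Icc.2 (ht.1.trans ht.2)) ht ht.1
  rw [entropy_zero, entropy_one_sub_inv_one_add_four_mul_beta] at this
  linarith

theorem deltaGV_five_mem_Icc_and_entropy (hR0 : Real.logb 2 √5 ≤ R) (hR : R ≤ RPlus5 ε) :
    deltaGV (2 * R - Real.logb 2 5) 5 ∈ Set.Icc 0 (1 - 1 / ((5 : ℕ) : ℝ)) ∧
      entropy 5 (deltaGV (2 * R - Real.logb 2 5) 5) = 2 * (Real.logb 2 5 - R) := by
  rw [logb_two_sqrt_five] at hR0
  obtain ⟨hδ, hent⟩ := deltaGV_mem_Icc_and_entropy_deltaGV (q := 5) (by norm_num)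
    (r := 2 * R - Real.logb 2 5) (by linarith) (by
      push_cast
      linarith [RPlus5_le_logb_five ε])
  refine ⟨hδ, hent.trans ?_⟩
  push_cast
  ring

theorem one_sub_inv_one_add_four_mul_beta_le_deltaGV (hR0 : Real.logb 2 √5 ≤ R)
    (hR : R ≤ RPlus5 ε) : 1 - 1 / (1 + 4 * beta ε) ≤ deltaGV (2 * R - Real.logb 2 5) 5 := by
  obtain ⟨hδ, hent⟩ := deltaGV_five_mem_Icc_and_entropy hR0 hR
  rw [← (strictMonoOn_entropy (by norm_num)).le_iff_le
    (one_sub_inv_one_add_four_mul_beta_mem_Icc ε) hδ, hent,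
    entropy_one_sub_inv_one_add_four_mul_beta]
  linarith

theorem deltaGV_five_pos (h0 : 0 < ε) (h1 : ε < 1) (hR0 : Real.logb 2 √5 ≤ R)
    (hR : R ≤ RPlus5 ε) : 0 < deltaGV (2 * R - Real.logb 2 5) 5 := by
  have := beta_pos h0 h1
  refine lt_of_lt_of_le ?_ (one_sub_inv_one_add_four_mul_beta_le_deltaGV hR0 hR)
  rw [sub_pos, div_lt_one (by positivity)]
  linarith

theorem newBound5_eq (ε R : ℝ) :
    newBound5 ε R = -(deltaGV (2 * R - Real.logb 2 5) 5 * Real.logb 2 (beta ε) / 2) := by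
  rw [newBound5, beta]
  ring

theorem newBound5_pos (h0 : 0 < ε) (h1 : ε < 1) (hR0 : Real.logb 2 √5 ≤ R)
    (hR : R ≤ RPlus5 ε) : 0 < newBound5 ε R := by
  have hlogb : Real.logb 2 (beta ε) < 0 :=
    Real.logb_neg one_lt_two (beta_pos h0 h1) (beta_lt_one ε)
  rw [newBound5_eq]
  linarith [mul_neg_of_pos_of_neg (deltaGV_five_pos h0 h1 hR0 hR) hlogb]

theorem ceil_two_rpow_le (m : ℕ) (R : ℝ) :
    ⌈(2 : ℝ) ^ (((m + m : ℕ) : ℝ) * R)⌉₊ ≤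
      5 ^ m * ⌈(2 : ℝ) ^ ((2 * R - Real.logb 2 5) * m)⌉₊ := by
  have h5 : (2 : ℝ) ^ (Real.logb 2 5 * m) = 5 ^ m := by
    rw [Real.rpow_mul_natCast two_pos.le, Real.rpow_logb two_pos (by norm_num) (by norm_num)]
  have hsplit : ((m + m : ℕ) : ℝ) * R = Real.logb 2 5 * m + (2 * R - Real.logb 2 5) * m := by
    push_cast
    ring
  rw [hsplit, Real.rpow_add two_pos, h5]
  refine Nat.ceil_le.2 ?_
  push_cast
  gcongr
  exact Nat.le_ceil _

theorem exists_code_msgError_le_two_rpow (h0 : 0 < ε) (h1 : ε < 1) (hR0 : Real.logb 2 √5 ≤ R)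
    (hR : R ≤ RPlus5 ε) (m : ℕ) :
    ∃ C : Code 5 ⌈(2 : ℝ) ^ (((m + m : ℕ) : ℝ) * R)⌉₊ (m + m), ∀ μ,
      C.msgError ε μ ≤ 2 ^ (-(((m + m : ℕ) : ℝ) * newBound5 ε R)) := by
  obtain ⟨hδ, hent⟩ := deltaGV_five_mem_Icc_and_entropy hR0 hR
  have hδ0 := deltaGV_five_pos h0 h1 hR0 hR
  have hle := one_sub_inv_one_add_four_mul_beta_le_deltaGV hR0 hR
  have hbound := newBound5_eq ε R
  have hβ := beta_pos h0 h1
  set δ := deltaGV (2 * R - Real.logb 2 5) 5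
  have : NeZero ⌈(2 : ℝ) ^ (((m + m : ℕ) : ℝ) * R)⌉₊ := ⟨(Nat.ceil_pos.2 (by positivity)).ne'⟩
  obtain ⟨c, hc⟩ := exists_family_sum_pow_hammingDist_le_rpow (q := 5) (A := ZMod 5) (ι := Fin m)
    (J := Fin ⌈(2 : ℝ) ^ ((2 * R - Real.logb 2 5) * m)⌉₊) (by norm_num) (ZMod.card 5) hδ0 hδ.2 hβ
    (by
      rw [sub_le_comm, le_div_iff₀ (by positivity)] at hle
      push_cast
      linarith)
    (by
      have hrate : Real.logb 2 ((5 : ℕ) : ℝ) - entropy 5 δ = 2 * R - Real.logb 2 5 := by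
        rw [hent]
        push_cast
        ring
      rw [hrate, Fintype.card_fin, Fintype.card_fin]
      exact Nat.ceil_lt_add_one (by positivity))
  have hpow : (2 : ℝ) ^ (-(((m + m : ℕ) : ℝ) * newBound5 ε R)) = beta ε ^ (δ * m) := by
    calc (2 : ℝ) ^ (-(((m + m : ℕ) : ℝ) * newBound5 ε R))
        = 2 ^ (Real.logb 2 (beta ε) * (δ * m)) := by
          rw [hbound]
          push_cast
          ring_nf
      _ = beta ε ^ (δ * m) := by
          rw [Real.rpow_mul two_pos.le, Real.rpow_logb two_pos (by norm_num) hβ]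
  rw [hpow]
  rw [Fintype.card_fin] at hc
  exact exists_code_msgError_le_of_sum_pow_hammingDist_le h0.le h1.le (ceil_two_rpow_le m R) hc

theorem add_rpow_lt_rpow_add_rpow {x y p : ℝ} (hx : 0 < x) (hy : 0 < y) (hp : p < 1) :
    (x + y) ^ p < x ^ p + y ^ p := by
  have hsplit : ∀ z : ℝ, 0 < z → z ^ p = z * z ^ (p - 1) := fun z hz => by
    rw [Real.rpow_sub_one hz.ne', mul_div_cancel₀ _ hz.ne']
  have hp' : p - 1 < 0 := sub_neg.2 hp
  have hxy : (x + y) ^ (p - 1) < x ^ (p - 1) := Real.rpow_lt_rpow_of_neg hx (by linarith) hp'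
  have hyx : (x + y) ^ (p - 1) < y ^ (p - 1) := Real.rpow_lt_rpow_of_neg hy (by linarith) hp'
  rw [hsplit x hx, hsplit y hy, hsplit _ (add_pos hx hy), add_mul]
  gcongr

theorem beta_rpow_lt (h0 : 0 < ε) (h1 : ε < 1) {p : ℝ} (hp : p < 1) :
    beta ε ^ p < alpha ε ^ p * (1 + alpha ε ^ p) := by
  have hα := alpha_pos h0 h1
  calc beta ε ^ p = (alpha ε + alpha ε * alpha ε) ^ p := by rw [beta, mul_one_add]
    _ < alpha ε ^ p + (alpha ε * alpha ε) ^ p := add_rpow_lt_rpow_add_rpow hα (by positivity) hp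
    _ = alpha ε ^ p * (1 + alpha ε ^ p) := by rw [Real.mul_rpow hα.le hα.le, mul_one_add]

/- Gibbs' inequality gives `≤` with `1 + 4 β^{1/ρ}` in place of the square; it is strict for `ρ = 1`
because `δ_GV` is not the Gibbs point, and for `ρ > 1` because `x ↦ x^{1/ρ}` is strictly
subadditive. -/
theorem entropy_deltaGV_add_mul_logb_beta_rpow_lt (h0 : 0 < ε) (h1 : ε < 1)
    (hR0 : Real.logb 2 √5 ≤ R) (hR : R < RPlus5 ε) {ρ : ℝ} (hρ : 1 ≤ ρ) :
    entropy 5 (deltaGV (2 * R - Real.logb 2 5) 5) +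
        deltaGV (2 * R - Real.logb 2 5) 5 * Real.logb 2 (beta ε ^ (1 / ρ)) <
      Real.logb 2 ((1 + 2 * alpha ε ^ (1 / ρ)) ^ 2) := by
  obtain ⟨hδ, hent⟩ := deltaGV_five_mem_Icc_and_entropy hR0 hR.le
  have hδ0 := deltaGV_five_pos h0 h1 hR0 hR.le
  have hβ := beta_pos h0 h1
  set δ := deltaGV (2 * R - Real.logb 2 5) 5
  have hδ1 : δ < 1 := hδ.2.trans_lt (by norm_num)
  rcases hρ.eq_or_lt with rfl | hρ
  · rw [div_one, Real.rpow_one, Real.rpow_one, ← one_add_four_mul_beta]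
    have hgibbs : ((5 : ℕ) - 1) * beta ε * (1 - δ) ≠ δ := fun h => hR.ne <| by
      have hδt : δ = 1 - 1 / (1 + 4 * beta ε) := by
        rw [eq_sub_iff_add_eq, ← eq_sub_iff_add_eq', div_eq_iff (by positivity)]
        push_cast at h
        linarith
      rw [hδt, entropy_one_sub_inv_one_add_four_mul_beta] at hent
      linarith
    convert entropy_add_mul_logb_lt (q := 5) (by norm_num) hδ0 hδ1 hβ hgibbs using 3
    norm_num
  · refine (entropy_add_mul_logb_le (by norm_num) hδ0 hδ1 (by positivity)).trans_lt ?_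
    refine Real.logb_lt_logb one_lt_two (by norm_num; positivity) ?_
    have := beta_rpow_lt h0 h1 ((div_lt_one (by linarith)).2 hρ)
    push_cast
    linarith

theorem uniformExponent_lt_newBound5 (h0 : 0 < ε) (h1 : ε < 1) (hR0 : Real.logb 2 √5 ≤ R)
    (hR : R < RPlus5 ε) {ρ : ℝ} (hρ : 1 ≤ ρ) : uniformExponent 5 ε R ρ < newBound5 ε R := by
  have hρ0 : 0 < ρ := by linarith
  have hgibbs := entropy_deltaGV_add_mul_logb_beta_rpow_lt h0 h1 hR0 hR hρ
  rw [(deltaGV_five_mem_Icc_and_entropy hR0 hR.le).2, Real.logb_pow,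
    Real.logb_rpow_eq_mul_logb_of_pos (beta_pos h0 h1)] at hgibbs
  have := mul_lt_mul_of_pos_left hgibbs hρ0
  have hcancel : ρ * (1 / ρ * Real.logb 2 (beta ε)) = Real.logb 2 (beta ε) := by
    field_simp
  rw [newBound5_eq, uniformExponent, ← hcancel]
  push_cast at this ⊢
  linarith

theorem expurgatedInf_lt_newBound5 (h0 : 0 < ε) (h1 : ε < 1) (hR0 : Real.logb 2 √5 ≤ R)
    (hR : R < RPlus5 ε) : expurgatedInf 5 ε R < newBound5 ε R := by
  have hcos : 1 + 1 / Real.cos (Real.pi / (5 : ℕ)) = √5 := by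
    push_cast
    rw [Real.cos_pi_div_five]
    field_simp
    linarith [Real.sq_sqrt (show (0 : ℝ) ≤ 5 by norm_num)]
  refine expurgatedInf_lt (by decide) (by norm_num) h0 h1 ?_ (newBound5_pos h0 h1 hR0 hR.le)
    fun ρ hρ => uniformExponent_lt_newBound5 h0 h1 hR0 hR hρ
  rw [hcos]
  push_cast
  linarith [logb_two_sqrt_five]

end Five

end Typewriter

theorem theorem3_general (ε : ℝ) (hε0 : 0 < ε) (hε1 : ε < 1) (R : ℝ)
    (hR0 : Real.logb 2 (Real.sqrt 5) ≤ R) (hR : R ≤ Typewriter.RPlus5 ε) :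
    (Typewriter.newBound5 ε R : EReal) ≤ Typewriter.reliability 5 ε R ∧
    (Typewriter.newBound5 ε R : EReal) ≤ Typewriter.reliabilityMax 5 ε R ∧
    (R < Typewriter.RPlus5 ε →
      Typewriter.expurgatedInf 5 ε R < (Typewriter.newBound5 ε R : EReal)) := by
  have hcode : ∃ᶠ n : ℕ in Filter.atTop, ∃ C : Typewriter.Code 5 ⌈(2 : ℝ) ^ ((n : ℝ) * R)⌉₊ n,
      ∀ m, C.msgError ε m ≤ 2 ^ (-((n : ℝ) * Typewriter.newBound5 ε R)) :=
    Filter.frequently_atTop.2 fun m => ⟨m + m, Nat.le_add_left m m,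
      Typewriter.exists_code_msgError_le_two_rpow hε0 hε1 hR0 hR m⟩
  exact ⟨Typewriter.le_reliability hε0.le hε1.le hcode,
    Typewriter.le_reliabilityMax hε0.le hε1.le hcode,
    Typewriter.expurgatedInf_lt_newBound5 hε0 hε1 hR0⟩

theorem theorem3 (ε : ℝ) (hε0 : 0 < ε) (hε : ε ≤ 1 / 2) (R : ℝ)
    (hR0 : Real.logb 2 (Real.sqrt 5) ≤ R) (hR : R ≤ Typewriter.RPlus5 ε) :
    (Typewriter.newBound5 ε R : EReal) ≤ Typewriter.reliability 5 ε R ∧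
    (Typewriter.newBound5 ε R : EReal) ≤ Typewriter.reliabilityMax 5 ε R ∧
    (R < Typewriter.RPlus5 ε →
      Typewriter.expurgatedInf 5 ε R < (Typewriter.newBound5 ε R : EReal)) := by
  exact theorem3_general ε hε0 (by linarith) R hR0 hR
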